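/- Let $p$ be a prime and let $(R,\mathcal M)$ be a discrete valuation ring which is complete in the $\mathcal M$-adic topology and whose residue field $R/\mathcal M$ is finite of characteristic $p$; let $\mathbb K$ be its field of fractions. A formal group law of dimension $d$ over $R$ is a tuple $\underline F=(F_1,\dots,F_d)$ of formal power series over $R$ in $X_1,\dots,X_d,Y_1,\dots,Y_d$ such that $\underline F(\underline X,\underline 0)=\underline X$, $\underline F(\underline 0,\underline Y)=\underline Y$ and $\underline F(\underline X,\underline F(\underline Y,\underline Z))=\underline F(\underline F(\underline X,\underline Y),\underline Z)$. An $R$-standard group of dimension $d$ is a topological group $G$ with underlying space $\mathcal M^{(d)}=\mathcal M\times\dots\times\mathcal M$ ($d$ factors) for which there is such an $\underline F$ with $g\cdot h=\underline F(g,h)$ for all $g,h\in G$. Let $\underline B$ be the part of $\underline F$ that is bilinear in $\underline X,\underline Y$ (the terms of degree one in each), let $L(G)=\mathcal M^{(d)}$ with the bracket $(v,w)=\underline B(v,w)-\underline B(w,v)$, and let $\mathcal L_G=L(G)\otimes_R\mathbb K$ with the extended bracket be the Lie algebra of $G$. It is called perfect if it equals its derived subalgebra, the $\mathbb K$-span of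 all brackets. For $n\ge 1$ put $K_n=(\mathcal M^n)^{(d)}$, an open normal subgroup of finite index in $G$. For a finite group $\Gamma$ generated by a subset $S$, let $\mathrm{diam}(\Gamma,S)$ be the least $m\ge 0$ such that every element of $\Gamma$ is a product $s_1\cdots s_m$ with all $s_i\in S\cup S^{-1}\cup\{1\}$, and let $\mathrm{diam}(\Gamma)$ be the maximum of $\mathrm{diam}(\Gamma,S)$ over all generating sets $S$ of $\Gamma$. **Theorem.** For every $d$ there is a constant $C_2=C_2(d)>0$, depending only on $d$, with the following property. Let $R$ be as above (for any prime $p$) and let $G$ be a $d$-dimensional $R$-standard group whose Lie algebra $\mathcal L_G$ is perfect. Then there is a constant $C_1=C_1(G)>0$ such that for all $n\ge 1$ $$\mathrm{diam}(G/K_n)\le C_1\,\bigl(\log|G/K_n|\bigr)^{C_2}.$$ -/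

import Mathlib

open scoped TensorProduct

section WordDiameter

variable {Γ : Type*} [Group Γ]

/-- The closed word-ball of radius `n`: all products `s₁ ⋯ sₙ` with `sᵢ ∈ S ∪ S⁻¹ ∪ {1}`. -/
def wordBall (S : Set Γ) (n : ℕ) : Set Γ :=
  {g | ∃ s : Fin n → Γ, (∀ i, s i ∈ S ∨ (s i)⁻¹ ∈ S ∨ s i = 1) ∧ (List.ofFn s).prod = g}

/-- `diam(Γ, S)`, the least `n` such that the word-ball of radius `n` is all of `Γ`
(meaningful when `Γ` is finite and `S` generates `Γ`). -/
noncomputable def diamWrt (S : Set Γ) : ℕ :=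
  sInf {n : ℕ | wordBall S n = Set.univ}

variable (Γ) in
/-- The worst-case diameter: the maximum of `diam(Γ, S)` over all generating sets `S`
(meaningful when `Γ` is finite: the supremum is then one of a finite nonempty set). -/
noncomputable def worstDiam : ℕ :=
  sSup {k : ℕ | ∃ S : Set Γ, Subgroup.closure S = ⊤ ∧ k = diamWrt S}

end WordDiameter

/-- A formal group law of dimension `d` over `R`: a `d`-tuple of power series
in the variables `X₁, …, X_d` (the variables `Sum.inl j`) and `Y₁, …, Y_d` (the variables
`Sum.inr j`) such that `F(X, 0) = X`, `F(0, Y) = Y` and `F(X, F(Y, Z)) = F(F(X, Y), Z)`. -/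
structure FormalGroupLaw (R : Type*) [CommRing R] (d : ℕ) where
  /-- The components `F₁, …, F_d`. -/
  toFun : Fin d → MvPowerSeries (Fin d ⊕ Fin d) R
  right_zero : ∀ i, (toFun i).subst
    (Sum.elim (fun j => MvPowerSeries.X j) (fun _ => 0) :
      Fin d ⊕ Fin d → MvPowerSeries (Fin d) R) = MvPowerSeries.X i
  left_zero : ∀ i, (toFun i).subst
    (Sum.elim (fun _ => 0) (fun j => MvPowerSeries.X j) :
      Fin d ⊕ Fin d → MvPowerSeries (Fin d) R) = MvPowerSeries.X i
  /-- The three blocks of variables `X`, `Y`, `Z` are `inl j`, `inr (inl j)`, `inr (inr j)`. -/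
  assoc : ∀ i, (toFun i).subst
      (Sum.elim (fun j => MvPowerSeries.X (Sum.inl j))
        (fun j => (toFun j).subst
          (Sum.elim (fun k => MvPowerSeries.X (Sum.inr (Sum.inl k)))
            (fun k => MvPowerSeries.X (Sum.inr (Sum.inr k))) :
            Fin d ⊕ Fin d → MvPowerSeries (Fin d ⊕ Fin d ⊕ Fin d) R)) :
        Fin d ⊕ Fin d → MvPowerSeries (Fin d ⊕ Fin d ⊕ Fin d) R)
    = (toFun i).subst
      (Sum.elim
        (fun j => (toFun j).subst
          (Sum.elim (fun k => MvPowerSeries.X (Sum.inl k))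
            (fun k => MvPowerSeries.X (Sum.inr (Sum.inl k))) :
            Fin d ⊕ Fin d → MvPowerSeries (Fin d ⊕ Fin d ⊕ Fin d) R))
        (fun j => MvPowerSeries.X (Sum.inr (Sum.inr j))) :
        Fin d ⊕ Fin d → MvPowerSeries (Fin d ⊕ Fin d ⊕ Fin d) R)

namespace FormalGroupLaw

variable {R : Type*} [CommRing R] {d : ℕ} (F : FormalGroupLaw R d)

theorem constantCoeff_eq_zero (i : Fin d) :
    MvPowerSeries.constantCoeff (F.toFun i) = 0 := by
  classical
  have ha : MvPowerSeries.HasSubst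
      (Sum.elim (fun j => MvPowerSeries.X j) (fun _ => 0) :
        Fin d ⊕ Fin d → MvPowerSeries (Fin d) R) :=
    MvPowerSeries.hasSubst_of_constantCoeff_zero (by rintro (j | j) <;> simp)
  have h := congrArg MvPowerSeries.constantCoeff (F.right_zero i)
  rw [MvPowerSeries.constantCoeff_subst ha, finsum_eq_single _ 0] at h
  · simpa using h
  · intro m hm
    obtain ⟨s, hs⟩ : ∃ s, m s ≠ 0 := by
      by_contra! hc
      exact hm (Finsupp.ext hc)
    have : MvPowerSeries.constantCoeff (m.prod fun s e =>
        ((Sum.elim (fun j => MvPowerSeries.X j) (fun _ => 0) :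
          Fin d ⊕ Fin d → MvPowerSeries (Fin d) R) s) ^ e) = 0 := by
      rw [Finsupp.prod, map_prod]
      refine Finset.prod_eq_zero (i := s) (by simp [hs]) ?_
      rcases s with s | s <;> simp [hs]
    rw [this, smul_zero]

variable [IsLocalRing R]

/-- The bilinear part `B(v, w)` of `F`, the sum of the terms of `F` of degree one in each of
`X` and `Y`, evaluated on the module `𝓜^d`. -/
noncomputable def bilin :
    (Fin d → IsLocalRing.maximalIdeal R) →ₗ[R] (Fin d → IsLocalRing.maximalIdeal R) →ₗ[R]
      (Fin d → IsLocalRing.maximalIdeal R) :=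
  LinearMap.mk₂ R
    (fun v w i => ∑ j, ∑ k,
      (MvPowerSeries.coeff
        (Finsupp.single (Sum.inl j) 1 + Finsupp.single (Sum.inr k) 1) (F.toFun i) *
          (v j : R)) • w k)
    (by
      intro v v' w
      funext i
      simp [mul_add, add_smul, Finset.sum_add_distrib])
    (by
      intro c v w
      funext i
      simp only [Pi.smul_apply, Finset.smul_sum, smul_smul]
      refine Finset.sum_congr rfl fun j _ => Finset.sum_congr rfl fun k _ => ?_
      congr 1
      simp only [Submodule.coe_smul, smul_eq_mul]
      ring)
    (by
      intro v w w'
      funext i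
      simp [smul_add, Finset.sum_add_distrib])
    (by
      intro c v w
      funext i
      simp only [Pi.smul_apply, Finset.smul_sum]
      refine Finset.sum_congr rfl fun j _ => Finset.sum_congr rfl fun k _ => ?_
      rw [smul_comm])

/-- The bracket `(v, w) = B(v, w) - B(w, v)` of the Lie ring `L(G) = 𝓜^d`. -/
noncomputable def lieBracket :
    (Fin d → IsLocalRing.maximalIdeal R) →ₗ[R] (Fin d → IsLocalRing.maximalIdeal R) →ₗ[R]
      (Fin d → IsLocalRing.maximalIdeal R) :=
  F.bilin - F.bilin.flip

/-- The underlying space of the Lie algebra `K ⊗ L(G)`, where `K` is the field of fractions. -/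
abbrev LieAlg (R : Type*) [CommRing R] [IsLocalRing R] (d : ℕ) : Type _ :=
  FractionRing R ⊗[R] (Fin d → IsLocalRing.maximalIdeal R)

/-- The bracket of the Lie algebra `K ⊗ L(G)`: the `K`-bilinear extension of the bracket of
`L(G)`, that is, `(a ⊗ v, b ⊗ w) = a b ⊗ (v, w)`. -/
noncomputable def lieAlgBracket :
    LieAlg R d →ₗ[FractionRing R] LieAlg R d →ₗ[FractionRing R] LieAlg R d :=
  LinearMap.BilinMap.baseChange (FractionRing R) F.lieBracket

/-- The derived subalgebra of `K ⊗ L(G)`: the `K`-linear span of all brackets. -/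
noncomputable def derivedSubalgebra : Submodule (FractionRing R) (LieAlg R d) :=
  Submodule.span (FractionRing R) {z | ∃ x y, F.lieAlgBracket x y = z}

/-- The Lie algebra `K ⊗ L(G)` is perfect: it equals its derived subalgebra. -/
def LieAlgPerfect : Prop :=
  F.derivedSubalgebra = ⊤

end FormalGroupLaw

section Standard

/-- The `𝓜`-adic topology of a local ring `(R, 𝓜)`. -/
@[reducible]
def localAdicTopology (R : Type*) [CommRing R] [IsLocalRing R] : TopologicalSpace R :=
  (IsLocalRing.maximalIdeal R).adicTopology

attribute [local instance] localAdicTopology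

/-- An `R`-standard structure of dimension `d` on a topological group `G`: an identification
of the space `G` with `𝓜^d` (with the topology coming from the `𝓜`-adic topology of `R`) and a
formal group law `F` with `g · h = F(g, h)` for all `g`, `h`. Here `F(g, h)` is the sum of the
series obtained by substituting the coordinates of `g` for `X` and those of `h` for `Y`. -/
structure StandardGroup (R : Type*) [CommRing R] [IsLocalRing R] (d : ℕ)
    (G : Type*) [Group G] [TopologicalSpace G] [IsTopologicalGroup G] where
  /-- The identification of `G` with `𝓜^d`. -/
  chart : G ≃ₜ (Fin d → IsLocalRing.maximalIdeal R)
  /-- The formal group law. -/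
  law : FormalGroupLaw R d
  mul_eq : ∀ (g h : G) (i : Fin d),
    HasSum (fun m : Fin d ⊕ Fin d →₀ ℕ =>
        MvPowerSeries.coeff m (law.toFun i) *
          m.prod fun s e =>
            (Sum.elim (fun j => (chart g j : R)) (fun j => (chart h j : R)) s) ^ e)
      (chart (g * h) i : R)

namespace StandardGroup

variable {R : Type*} [CommRing R] [IsLocalRing R] {d : ℕ}
  {G : Type*} [Group G] [TopologicalSpace G] [IsTopologicalGroup G] (E : StandardGroup R d G)

/-- Multiplication respects coordinatewise congruence modulo `𝓜^n`. -/
theorem mul_congr (n : ℕ) {g g' h h' : G}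
    (hg : ∀ i, (E.chart g i : R) - E.chart g' i ∈ IsLocalRing.maximalIdeal R ^ n)
    (hh : ∀ i, (E.chart h i : R) - E.chart h' i ∈ IsLocalRing.maximalIdeal R ^ n) (i : Fin d) :
    (E.chart (g * h) i : R) - E.chart (g' * h') i ∈ IsLocalRing.maximalIdeal R ^ n := by
  have : IsTopologicalRing R :=
    ((IsLocalRing.maximalIdeal R).nonarchimedean).toIsTopologicalRing
  have hc : IsClosed ((IsLocalRing.maximalIdeal R ^ n : Ideal R) : Set R) :=
    ((IsLocalRing.maximalIdeal R).openAddSubgroup n).isClosed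
  have key := (E.mul_eq g h i).sub (E.mul_eq g' h' i)
  refine hc.mem_of_tendsto key (Filter.Eventually.of_forall fun t => ?_)
  refine Ideal.sum_mem _ fun m _ => ?_
  rw [← mul_sub]
  refine Ideal.mul_mem_left _ _ ?_
  rw [← Ideal.Quotient.eq, Finsupp.prod, Finsupp.prod, map_prod, map_prod]
  refine Finset.prod_congr rfl fun s _ => ?_
  rw [map_pow, map_pow]
  congr 1
  rw [Ideal.Quotient.eq]
  rcases s with s | s
  · exact hg s
  · exact hh s

theorem chart_one_mem (n : ℕ) (i : Fin d) :
    (E.chart 1 i : R) ∈ IsLocalRing.maximalIdeal R ^ n := by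
  have : IsTopologicalRing R :=
    ((IsLocalRing.maximalIdeal R).nonarchimedean).toIsTopologicalRing
  have hc : IsClosed ((IsLocalRing.maximalIdeal R ^ n : Ideal R) : Set R) :=
    ((IsLocalRing.maximalIdeal R).openAddSubgroup n).isClosed
  set u : G := E.chart.symm 0 with hu
  have hu0 : ∀ j, (E.chart u j : R) = 0 := fun j => by simp [hu]
  have huu : ∀ i, (E.chart (u * u) i : R) ∈ IsLocalRing.maximalIdeal R ^ n := fun i => by
    refine hc.mem_of_tendsto (E.mul_eq u u i) (Filter.Eventually.of_forall fun t => ?_)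
    refine Ideal.sum_mem _ fun m _ => ?_
    by_cases hm : m = 0
    · subst hm
      rw [MvPowerSeries.coeff_zero_eq_constantCoeff_apply, E.law.constantCoeff_eq_zero, zero_mul]
      exact Ideal.zero_mem _
    · obtain ⟨s, hs⟩ : ∃ s, m s ≠ 0 := by
        by_contra! hc
        exact hm (Finsupp.ext hc)
      rw [Finsupp.prod, Finset.prod_eq_zero (i := s) (by simp [hs]), mul_zero]
      · exact Ideal.zero_mem _
      · rcases s with s | s <;> simp [hu0, hs]
  have h := E.mul_congr n (g := u * u) (g' := u) (h := u⁻¹) (h' := u⁻¹)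
    (fun i => by rw [hu0, sub_zero]; exact huu i) (fun i => by simp) i
  simpa [hu0] using h

/-- The subgroup `K_n = (𝓜^n)^d` of `G`, for `n ≥ 1` (for `n = 0` it is all of `G`). -/
def K (n : ℕ) : Subgroup G where
  carrier := {g | ∀ i, (E.chart g i : R) ∈ IsLocalRing.maximalIdeal R ^ n}
  one_mem' := E.chart_one_mem n
  mul_mem' := fun {a b} ha hb i => by
    have := E.mul_congr n (g := a) (g' := 1) (h := b) (h' := 1)
      (fun i => Ideal.sub_mem _ (ha i) (E.chart_one_mem n i))
      (fun i => Ideal.sub_mem _ (hb i) (E.chart_one_mem n i)) i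
    rw [mul_one] at this
    exact (Submodule.sub_mem_iff_left _ (E.chart_one_mem n i)).1 this
  inv_mem' := fun {a} ha i => by
    have := E.mul_congr n (g := a⁻¹) (g' := a⁻¹) (h := a) (h' := 1)
      (fun i => by simp) (fun i => Ideal.sub_mem _ (ha i) (E.chart_one_mem n i)) i
    rw [mul_one, inv_mul_cancel] at this
    exact (Submodule.sub_mem_iff_right _ (E.chart_one_mem n i)).1 this

instance K_normal (n : ℕ) : (E.K n).Normal where
  conj_mem a ha g i := by
    have h1 := E.mul_congr n (g := g) (g' := g) (h := a) (h' := 1)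
      (fun i => by simp) (fun i => Ideal.sub_mem _ (ha i) (E.chart_one_mem n i))
    have h2 := E.mul_congr n (h := g⁻¹) (h' := g⁻¹) h1 (fun i => by simp) i
    rw [mul_one, mul_inv_cancel] at h2
    exact (Submodule.sub_mem_iff_left _ (E.chart_one_mem n i)).1 h2

end StandardGroup

end Standard

/-!
The proof is a Solovay-Kitaev argument. In a standard group the commutator of `g ∈ K_a` and
`h ∈ K_b` is the Lie bracket of their coordinates up to an error of depth `a + b + min a b`
(`StandardGroup.coord_commutatorElement_sub_mem`), because the formal group law is
`X + Y + B(X, Y)` plus mixed terms of degree at least three. If the Lie algebra is perfect, then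
for some constant `c` every vector of depth `a + b + c` is a sum of `d` brackets of vectors of
depths `a` and `b` (`FormalGroupLaw.exists_bracket_decomposition`).

Say that words of length `ℓ` cover the window `(m, m']` if they approximate every element of `K_m`
modulo `K_{m'}`. If words of length `ℓ` cover `(a, a + k]` and `(b, b + k]`, then products of `d`
commutators of such words cover `(a + b + c, a + b + k]` (`StandardGroup.Covers.commutator`). With
`k = 2c` this loses half of the width, but two consecutive windows of width `c` compose to one of
width `2c`. So words `8d` times as long cover windows at twice the depth, and iterating
from bounded depth gives words of length polynomial in `n`, of degree depending only on `d`, that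
cover `(1, n]` (`StandardGroup.exists_covers_polynomial`). At bounded depth one length serves all
generating sets, as a finite quotient has only finitely many subsets. Finally `log |G / K_n|` grows
at least linearly in `n`, since in positive dimension every layer `K_n / K_{n+1}` is nontrivial.
-/

open scoped commutatorElement

/-! ### Word balls -/

section WordBalls

variable {Γ Δ : Type*} [Group Γ] [Group Δ]

theorem mem_wordBall_iff {S : Set Γ} {n : ℕ} {g : Γ} :
    g ∈ wordBall S n ↔
      ∃ l : List Γ, l.length = n ∧ (∀ x ∈ l, x ∈ S ∨ x⁻¹ ∈ S ∨ x = 1) ∧ l.prod = g := by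
  constructor
  · rintro ⟨s, hs, rfl⟩
    exact ⟨List.ofFn s, by simp, by simpa [List.mem_ofFn] using hs, rfl⟩
  · rintro ⟨l, rfl, hl, rfl⟩
    exact ⟨l.get, fun i => hl _ (l.get_mem i), by rw [List.ofFn_get]⟩

theorem one_mem_wordBall (S : Set Γ) (n : ℕ) : (1 : Γ) ∈ wordBall S n :=
  mem_wordBall_iff.2 ⟨List.replicate n 1, by simp,
    fun _ hx => Or.inr (Or.inr (List.eq_of_mem_replicate hx)), by simp⟩

theorem mul_mem_wordBall {S : Set Γ} {m n : ℕ} {g h : Γ} (hg : g ∈ wordBall S m)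
    (hh : h ∈ wordBall S n) : g * h ∈ wordBall S (m + n) := by
  obtain ⟨l, rfl, hl, rfl⟩ := mem_wordBall_iff.1 hg
  obtain ⟨l', rfl, hl', rfl⟩ := mem_wordBall_iff.1 hh
  refine mem_wordBall_iff.2 ⟨l ++ l', by simp, fun x hx => ?_, by simp⟩
  rcases List.mem_append.1 hx with hx | hx
  exacts [hl x hx, hl' x hx]

theorem wordBall_mono (S : Set Γ) {m n : ℕ} (h : m ≤ n) : wordBall S m ⊆ wordBall S n := by
  intro g hg
  obtain ⟨k, rfl⟩ := Nat.exists_eq_add_of_le h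
  simpa using mul_mem_wordBall hg (one_mem_wordBall S k)

theorem inv_mem_wordBall {S : Set Γ} {n : ℕ} {g : Γ} (hg : g ∈ wordBall S n) :
    g⁻¹ ∈ wordBall S n := by
  obtain ⟨l, rfl, hl, rfl⟩ := mem_wordBall_iff.1 hg
  refine mem_wordBall_iff.2 ⟨(l.map (·⁻¹)).reverse, by simp, fun x hx => ?_, ?_⟩
  · obtain ⟨y, hy, rfl⟩ := List.mem_map.1 (List.mem_reverse.1 hx)
    rcases hl y hy with h | h | h
    · exact Or.inr (Or.inl (by simpa using h))
    · exact Or.inl h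
    · exact Or.inr (Or.inr (by simp [h]))
  · rw [List.prod_inv_reverse]

theorem commutatorElement_mem_wordBall {S : Set Γ} {n : ℕ} {g h : Γ} (hg : g ∈ wordBall S n)
    (hh : h ∈ wordBall S n) : ⁅g, h⁆ ∈ wordBall S (4 * n) := by
  rw [commutatorElement_def, show 4 * n = n + n + n + n by ring]
  exact mul_mem_wordBall (mul_mem_wordBall (mul_mem_wordBall hg hh) (inv_mem_wordBall hg))
    (inv_mem_wordBall hh)

theorem list_prod_mem_wordBall {S : Set Γ} {n : ℕ} {l : List Γ}
    (hl : ∀ x ∈ l, x ∈ wordBall S n) : l.prod ∈ wordBall S (l.length * n) := by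
  induction l with
  | nil => exact one_mem_wordBall S _
  | cons x l ih =>
    rw [List.prod_cons, List.length_cons, add_mul, one_mul, add_comm]
    exact mul_mem_wordBall (hl x (by simp)) (ih fun y hy => hl y (by simp [hy]))

theorem image_wordBall (f : Γ →* Δ) (S : Set Γ) (n : ℕ) :
    f '' wordBall S n = wordBall (f '' S) n := by
  apply Set.Subset.antisymm
  · rintro _ ⟨g, hg, rfl⟩
    obtain ⟨l, rfl, hl, rfl⟩ := mem_wordBall_iff.1 hg
    refine mem_wordBall_iff.2 ⟨l.map f, by simp, fun x hx => ?_, (map_list_prod f l).symm⟩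
    obtain ⟨y, hy, rfl⟩ := List.mem_map.1 hx
    rcases hl y hy with h | h | h
    · exact Or.inl ⟨y, h, rfl⟩
    · exact Or.inr (Or.inl ⟨y⁻¹, h, map_inv f y⟩)
    · exact Or.inr (Or.inr (by simp [h]))
  · rintro _ ⟨s, hs, rfl⟩
    have hlift : ∀ i, ∃ t : Γ, (t ∈ S ∨ t⁻¹ ∈ S ∨ t = 1) ∧ f t = s i := fun i => by
      rcases hs i with ⟨t, ht, e⟩ | ⟨t, ht, e⟩ | h
      · exact ⟨t, Or.inl ht, e⟩
      · exact ⟨t⁻¹, Or.inr (Or.inl (by simpa using ht)), by rw [map_inv, e, inv_inv]⟩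
      · exact ⟨1, Or.inr (Or.inr rfl), by rw [h, map_one]⟩
    choose t ht e using hlift
    refine ⟨(List.ofFn t).prod, ⟨t, ht, rfl⟩, ?_⟩
    rw [map_list_prod, List.map_ofFn]
    congr 2
    exact funext e

theorem wordBall_insert_one (S : Set Γ) (n : ℕ) : wordBall (insert 1 S) n = wordBall S n := by
  have h : ∀ x : Γ, (x ∈ insert 1 S ∨ x⁻¹ ∈ insert 1 S ∨ x = 1) ↔ (x ∈ S ∨ x⁻¹ ∈ S ∨ x = 1) := by
    intro x
    simp only [Set.mem_insert_iff, inv_eq_one]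
    tauto
  simp only [wordBall, h]

theorem exists_mem_wordBall {S : Set Γ} {g : Γ} (hg : g ∈ Subgroup.closure S) :
    ∃ n, g ∈ wordBall S n := by
  induction hg using Subgroup.closure_induction with
  | mem x hx => exact ⟨1, mem_wordBall_iff.2 ⟨[x], rfl, by simp [hx], by simp⟩⟩
  | one => exact ⟨0, one_mem_wordBall S 0⟩
  | mul x y _ _ hx hy =>
    obtain ⟨m, hm⟩ := hx
    obtain ⟨n, hn⟩ := hy
    exact ⟨m + n, mul_mem_wordBall hm hn⟩
  | inv x _ hx =>
    obtain ⟨m, hm⟩ := hx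
    exact ⟨m, inv_mem_wordBall hm⟩

variable (Γ) in
/-- A finite group has finitely many subsets, so one radius serves all generating sets. -/
theorem exists_forall_wordBall_eq_univ [Finite Γ] :
    ∃ N, ∀ S : Set Γ, Subgroup.closure S = ⊤ → wordBall S N = Set.univ := by
  have h : ∀ (S : Set Γ) (g : Γ), ∃ n, Subgroup.closure S = ⊤ → g ∈ wordBall S n := fun S g => by
    by_cases hS : Subgroup.closure S = ⊤
    · obtain ⟨n, hn⟩ := exists_mem_wordBall (S := S) (g := g) (by simp [hS])
      exact ⟨n, fun _ => hn⟩
    · exact ⟨0, fun h => absurd h hS⟩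
  choose n hn using h
  obtain ⟨N, hN⟩ := (Set.finite_range fun q : Set Γ × Γ => n q.1 q.2).bddAbove
  exact ⟨N, fun S hS => Set.eq_univ_of_forall fun g =>
    wordBall_mono S (hN ⟨(S, g), rfl⟩) (hn S g hS)⟩

theorem worstDiam_le {r : ℕ}
    (h : ∀ S : Set Γ, Subgroup.closure S = ⊤ → wordBall S r = Set.univ) : worstDiam Γ ≤ r := by
  refine csSup_le ⟨_, Set.univ, Subgroup.closure_univ, rfl⟩ ?_
  rintro _ ⟨S, hS, rfl⟩
  exact Nat.sInf_le (h S hS)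

/-- The full preimage of a generating set containing `1` generates, as it contains the kernel. -/
theorem closure_preimage_insert_one {f : Γ →* Δ} (hf : Function.Surjective f) {S : Set Δ}
    (hS : Subgroup.closure S = ⊤) : Subgroup.closure (f ⁻¹' insert 1 S) = ⊤ := by
  refine eq_top_iff.2 fun g _ => ?_
  have hmap : (Subgroup.closure (f ⁻¹' insert 1 S)).map f = ⊤ := by
    rw [MonoidHom.map_closure, Set.image_preimage_eq _ hf, eq_top_iff, ← hS]
    exact Subgroup.closure_mono (Set.subset_insert _ _)
  obtain ⟨t, ht, e⟩ : f g ∈ (Subgroup.closure (f ⁻¹' insert 1 S)).map f := by simp [hmap]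
  have hk : t⁻¹ * g ∈ f ⁻¹' insert 1 S := by
    left
    rw [map_mul, map_inv, e, inv_mul_cancel]
  simpa using mul_mem ht (Subgroup.subset_closure hk)

end WordBalls

/-! ### Low-order terms of a formal group law -/

section LowOrder

/-- Substituting a variable `X j` for each variable `ι j` and `0` for all the others extracts the
coefficients at the monomials in the variables `ι j`. -/
theorem MvPowerSeries.coeff_subst_embedding {R σ τ : Type*} [CommRing R] [Finite σ] (ι : τ ↪ σ)
    (a : σ → MvPowerSeries τ R) (ha : ∀ j, a (ι j) = MvPowerSeries.X j)
    (ha0 : ∀ s, s ∉ Set.range ι → a s = 0) (f : MvPowerSeries σ R) (n : τ →₀ ℕ) :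
    MvPowerSeries.coeff n (f.subst a) = MvPowerSeries.coeff (n.mapDomain ι) f := by
  classical
  have hs : MvPowerSeries.HasSubst a := MvPowerSeries.hasSubst_of_constantCoeff_zero fun s => by
    by_cases h : s ∈ Set.range ι
    · obtain ⟨j, rfl⟩ := h
      simp [ha]
    · simp [ha0 s h]
  have hprod : ∀ n' : τ →₀ ℕ, ((n'.mapDomain ι).prod fun s e => a s ^ e) =
      MvPowerSeries.monomial n' (1 : R) := fun n' => by
    rw [← Finsupp.embDomain_eq_mapDomain, Finsupp.prod_embDomain]
    simp only [ha]
    induction n' using Finsupp.induction_linear with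
    | zero => simp
    | add x y hx hy =>
      rw [Finsupp.prod_add_index' (by simp) (by intros; rw [pow_add]), hx, hy,
        MvPowerSeries.monomial_mul_monomial, mul_one]
    | single s e => rw [Finsupp.prod_single_index (by simp), MvPowerSeries.X_pow_eq]
  rw [MvPowerSeries.coeff_subst hs, finsum_eq_single _ (n.mapDomain ι)]
  · rw [hprod, MvPowerSeries.coeff_monomial_same, smul_eq_mul, mul_one]
  · intro m hm
    by_cases hr : ↑m.support ⊆ Set.range ι
    · obtain ⟨n', rfl⟩ : ∃ n' : τ →₀ ℕ, n'.mapDomain ι = m :=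
        ⟨m.comapDomain ι ι.injective.injOn, Finsupp.mapDomain_comapDomain ι ι.injective m hr⟩
      rw [hprod, MvPowerSeries.coeff_monomial_ne, smul_zero]
      rintro rfl
      exact hm rfl
    · obtain ⟨s, hsm, hsr⟩ := Set.not_subset.1 hr
      have hsm' : m s ≠ 0 := by simpa using hsm
      rw [Finsupp.prod, Finset.prod_eq_zero (i := s) hsm, map_zero, smul_zero]
      rw [ha0 s hsr, zero_pow hsm']

namespace FormalGroupLaw

variable {R : Type*} [CommRing R] {d : ℕ} (F : FormalGroupLaw R d)

theorem coeff_mapDomain_inl (i : Fin d) (n : Fin d →₀ ℕ) :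
    MvPowerSeries.coeff (n.mapDomain Sum.inl) (F.toFun i) =
      MvPowerSeries.coeff n (MvPowerSeries.X i : MvPowerSeries (Fin d) R) := by
  rw [← F.right_zero i]
  refine (MvPowerSeries.coeff_subst_embedding Function.Embedding.inl _ (fun j => rfl) ?_ _ _).symm
  rintro (s | s) hs
  · exact absurd ⟨s, rfl⟩ hs
  · rfl

theorem coeff_mapDomain_inr (i : Fin d) (n : Fin d →₀ ℕ) :
    MvPowerSeries.coeff (n.mapDomain Sum.inr) (F.toFun i) =
      MvPowerSeries.coeff n (MvPowerSeries.X i : MvPowerSeries (Fin d) R) := by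
  rw [← F.left_zero i]
  refine (MvPowerSeries.coeff_subst_embedding Function.Embedding.inr _ (fun j => rfl) ?_ _ _).symm
  rintro (s | s) hs
  · rfl
  · exact absurd ⟨s, rfl⟩ hs

/-- The bilinear part of `F`, on the free module `R^d` rather than on `𝓜^d`. -/
noncomputable def freeBilin : (Fin d → R) →ₗ[R] (Fin d → R) →ₗ[R] (Fin d → R) :=
  LinearMap.mk₂ R
    (fun v w i => ∑ j, ∑ k,
      MvPowerSeries.coeff
        (Finsupp.single (Sum.inl j) 1 + Finsupp.single (Sum.inr k) 1) (F.toFun i) * (v j * w k))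
    (fun v v' w => by
      funext i
      simp only [Pi.add_apply, ← Finset.sum_add_distrib]
      exact Finset.sum_congr rfl fun j _ => Finset.sum_congr rfl fun k _ => by ring)
    (fun c v w => by
      funext i
      simp only [Pi.smul_apply, smul_eq_mul, Finset.mul_sum]
      exact Finset.sum_congr rfl fun j _ => Finset.sum_congr rfl fun k _ => by ring)
    (fun v w w' => by
      funext i
      simp only [Pi.add_apply, ← Finset.sum_add_distrib]
      exact Finset.sum_congr rfl fun j _ => Finset.sum_congr rfl fun k _ => by ring)
    (fun c v w => by
      funext i
      simp only [Pi.smul_apply, smul_eq_mul, Finset.mul_sum]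
      exact Finset.sum_congr rfl fun j _ => Finset.sum_congr rfl fun k _ => by ring)

theorem freeBilin_apply (v w : Fin d → R) (i : Fin d) :
    F.freeBilin v w i = ∑ j, ∑ k, MvPowerSeries.coeff
      (Finsupp.single (Sum.inl j) 1 + Finsupp.single (Sum.inr k) 1) (F.toFun i) * (v j * w k) :=
  rfl

/-- The exponents of the terms of total degree at most two which can occur in `F_i`: the
monomials `X_i`, `Y_i` and `X_j Y_k`. -/
noncomputable def lowExponent (i : Fin d) : Bool ⊕ (Fin d × Fin d) → (Fin d ⊕ Fin d →₀ ℕ)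
  | Sum.inl false => Finsupp.single (Sum.inl i) 1
  | Sum.inl true => Finsupp.single (Sum.inr i) 1
  | Sum.inr (j, k) => Finsupp.single (Sum.inl j) 1 + Finsupp.single (Sum.inr k) 1

theorem lowExponent_injective (i : Fin d) : Function.Injective (lowExponent i) := by
  have hl : ∀ j k s : Fin d, (Finsupp.single (Sum.inl j) 1 + Finsupp.single (Sum.inr k) 1 :
      Fin d ⊕ Fin d →₀ ℕ) (Sum.inl s) = if j = s then 1 else 0 := by
    intro j k s
    simp [Finsupp.single_apply]
  have hr : ∀ j k s : Fin d, (Finsupp.single (Sum.inl j) 1 + Finsupp.single (Sum.inr k) 1 :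
      Fin d ⊕ Fin d →₀ ℕ) (Sum.inr s) = if k = s then 1 else 0 := by
    intro j k s
    simp [Finsupp.single_apply]
  rintro ((_ | _) | ⟨j, k⟩) ((_ | _) | ⟨j', k'⟩) h <;> simp only [lowExponent] at h
  · rfl
  · simpa [Finsupp.single_apply] using DFunLike.congr_fun h (Sum.inr i)
  · have := DFunLike.congr_fun h (Sum.inr k')
    rw [hr] at this
    simp at this
  · simpa [Finsupp.single_apply] using DFunLike.congr_fun h (Sum.inr i)
  · rfl
  · have := DFunLike.congr_fun h (Sum.inl j')
    rw [hl] at this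
    simp at this
  · have := DFunLike.congr_fun h (Sum.inr k)
    rw [hr] at this
    simp at this
  · have := DFunLike.congr_fun h (Sum.inl j)
    rw [hl] at this
    simp at this
  · have h1 := DFunLike.congr_fun h (Sum.inl j)
    have h2 := DFunLike.congr_fun h (Sum.inr k)
    rw [hl, hl] at h1
    rw [hr, hr] at h2
    simp only [if_true] at h1 h2
    have e1 : j' = j := by by_contra hne; simp [hne] at h1
    have e2 : k' = k := by by_contra hne; simp [hne] at h2
    rw [e1, e2]

/-- A single term of the series `F_i(v, w)`. -/
noncomputable def monomialValue (i : Fin d) (v w : Fin d → R) (m : Fin d ⊕ Fin d →₀ ℕ) : R :=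
  MvPowerSeries.coeff m (F.toFun i) * m.prod fun s e => (Sum.elim v w s) ^ e

theorem sum_monomialValue_lowExponent (i : Fin d) (v w : Fin d → R) :
    ∑ x, F.monomialValue i v w (lowExponent i x) = v i + w i + F.freeBilin v w i := by
  classical
  have hX : MvPowerSeries.coeff (Finsupp.single (Sum.inl i) 1) (F.toFun i) = 1 := by
    have := F.coeff_mapDomain_inl i (Finsupp.single i 1)
    rwa [Finsupp.mapDomain_single, MvPowerSeries.coeff_X, if_pos rfl] at this
  have hY : MvPowerSeries.coeff (Finsupp.single (Sum.inr i) 1) (F.toFun i) = 1 := by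
    have := F.coeff_mapDomain_inr i (Finsupp.single i 1)
    rwa [Finsupp.mapDomain_single, MvPowerSeries.coeff_X, if_pos rfl] at this
  rw [Fintype.sum_sum_type, Fintype.sum_bool, Fintype.sum_prod_type, freeBilin_apply, add_comm (v i)]
  congr 1
  · simp [monomialValue, lowExponent, hX, hY]
  · refine Finset.sum_congr rfl fun j _ => Finset.sum_congr rfl fun k _ => ?_
    rw [monomialValue, lowExponent, Finsupp.prod_add_index' (by simp) (by intros; rw [pow_add])]
    simp

/-- The Lie bracket, on the free module `R^d` rather than on `𝓜^d`. -/
noncomputable def freeBracket : (Fin d → R) →ₗ[R] (Fin d → R) →ₗ[R] (Fin d → R) :=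
  F.freeBilin - F.freeBilin.flip

theorem freeBracket_apply (v w : Fin d → R) :
    F.freeBracket v w = F.freeBilin v w - F.freeBilin w v := rfl

theorem coe_lieBracket [IsLocalRing R] (v w : Fin d → IsLocalRing.maximalIdeal R) (i : Fin d) :
    (F.lieBracket v w i : R) = F.freeBracket (fun j => (v j : R)) (fun j => (w j : R)) i := by
  simp [lieBracket, bilin, freeBracket_apply, freeBilin_apply, mul_assoc]

end FormalGroupLaw

end LowOrder

/-! ### The lattices `(𝓜^n)^d` -/

section PowLattice

variable {R : Type*} [CommRing R] [IsLocalRing R] {d : ℕ}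

variable (R d) in
/-- The submodule `(𝓜^n)^d` of `R^d`. -/
def powLattice (n : ℕ) : Submodule R (Fin d → R) :=
  Submodule.pi Set.univ fun _ => IsLocalRing.maximalIdeal R ^ n

theorem mem_powLattice {n : ℕ} {v : Fin d → R} :
    v ∈ powLattice R d n ↔ ∀ i, v i ∈ IsLocalRing.maximalIdeal R ^ n := by
  simp [powLattice, Submodule.mem_pi]

theorem powLattice_anti {m n : ℕ} (h : m ≤ n) : powLattice R d n ≤ powLattice R d m :=
  fun _ hv => mem_powLattice.2 fun i => Ideal.pow_le_pow_right h (mem_powLattice.1 hv i)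

theorem smul_mem_powLattice {n : ℕ} {c : R} (hc : c ∈ IsLocalRing.maximalIdeal R ^ n)
    (v : Fin d → R) : c • v ∈ powLattice R d n :=
  mem_powLattice.2 fun i => Ideal.mul_mem_right (v i) _ hc

namespace FormalGroupLaw

variable (F : FormalGroupLaw R d)

theorem freeBilin_mem {a b : ℕ} {v w : Fin d → R} (hv : v ∈ powLattice R d a)
    (hw : w ∈ powLattice R d b) : F.freeBilin v w ∈ powLattice R d (a + b) := by
  refine mem_powLattice.2 fun i => ?_
  rw [freeBilin_apply]
  refine Ideal.sum_mem _ fun j _ => Ideal.sum_mem _ fun k _ => Ideal.mul_mem_left _ _ ?_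
  rw [pow_add]
  exact Ideal.mul_mem_mul (mem_powLattice.1 hv j) (mem_powLattice.1 hw k)

theorem freeBracket_mem {a b : ℕ} {v w : Fin d → R} (hv : v ∈ powLattice R d a)
    (hw : w ∈ powLattice R d b) : F.freeBracket v w ∈ powLattice R d (a + b) := by
  rw [freeBracket_apply]
  exact sub_mem (F.freeBilin_mem hv hw) (add_comm a b ▸ F.freeBilin_mem hw hv)

/-- A mixed term of `F_i` of degree at least three is small. -/
theorem monomialValue_mem {a b : ℕ} {v w : Fin d → R} (hv : v ∈ powLattice R d a)
    (hw : w ∈ powLattice R d b) (i : Fin d) (m : Fin d ⊕ Fin d →₀ ℕ)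
    (hm : m ∉ Set.range (lowExponent i)) :
    F.monomialValue i v w m ∈ IsLocalRing.maximalIdeal R ^ (a + b + min a b) := by
  classical
  have hcoeff : MvPowerSeries.coeff m (F.toFun i) = 0 →
      F.monomialValue i v w m ∈ IsLocalRing.maximalIdeal R ^ (a + b + min a b) := fun h => by
    rw [monomialValue, h, zero_mul]
    exact Ideal.zero_mem _
  by_cases hl : ∃ j, m (Sum.inl j) ≠ 0
  swap
  · push Not at hl
    obtain ⟨n, rfl⟩ : ∃ n : Fin d →₀ ℕ, n.mapDomain Sum.inr = m := by
      refine ⟨m.comapDomain Sum.inr Sum.inr_injective.injOn,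
        Finsupp.mapDomain_comapDomain _ Sum.inr_injective m ?_⟩
      rintro (s | s) hs
      · simp [hl s] at hs
      · exact ⟨s, rfl⟩
    refine hcoeff ?_
    rw [coeff_mapDomain_inr, MvPowerSeries.coeff_X, if_neg]
    rintro rfl
    exact hm ⟨Sum.inl true, by simp [lowExponent]⟩
  by_cases hr : ∃ k, m (Sum.inr k) ≠ 0
  swap
  · push Not at hr
    obtain ⟨n, rfl⟩ : ∃ n : Fin d →₀ ℕ, n.mapDomain Sum.inl = m := by
      refine ⟨m.comapDomain Sum.inl Sum.inl_injective.injOn,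
        Finsupp.mapDomain_comapDomain _ Sum.inl_injective m ?_⟩
      rintro (s | s) hs
      · exact ⟨s, rfl⟩
      · simp [hr s] at hs
    refine hcoeff ?_
    rw [coeff_mapDomain_inl, MvPowerSeries.coeff_X, if_neg]
    rintro rfl
    exact hm ⟨Sum.inl false, by simp [lowExponent]⟩
  obtain ⟨j, hj⟩ := hl
  obtain ⟨k, hk⟩ := hr
  have hle : Finsupp.single (Sum.inl j) 1 + Finsupp.single (Sum.inr k) 1 ≤ m := by
    rintro (s | s)
    · by_cases h : j = s
      · subst h
        simpa using Nat.one_le_iff_ne_zero.2 hj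
      · simp [h]
    · by_cases h : k = s
      · subst h
        simpa using Nat.one_le_iff_ne_zero.2 hk
      · simp [h]
  obtain ⟨m', rfl⟩ := exists_add_of_le hle
  have hm' : m' ≠ 0 := by
    rintro rfl
    exact hm ⟨Sum.inr (j, k), by simp [lowExponent]⟩
  obtain ⟨s, hs⟩ : ∃ s, m' s ≠ 0 := by
    by_contra! hc
    exact hm' (Finsupp.ext hc)
  have hs' : (m'.prod fun s e => (Sum.elim v w s) ^ e) ∈
      IsLocalRing.maximalIdeal R ^ (min a b) := by
    rw [Finsupp.prod]
    refine Ideal.mem_of_dvd _ (Finset.dvd_prod_of_mem _ (Finsupp.mem_support_iff.2 hs)) ?_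
    refine Ideal.pow_mem_of_mem _ ?_ _ (Nat.pos_of_ne_zero hs)
    rcases s with s | s
    · exact Ideal.pow_le_pow_right (min_le_left a b) (mem_powLattice.1 hv s)
    · exact Ideal.pow_le_pow_right (min_le_right a b) (mem_powLattice.1 hw s)
  rw [monomialValue, Finsupp.prod_add_index' (by simp) (by intros; rw [pow_add]),
    Finsupp.prod_add_index' (by simp) (by intros; rw [pow_add])]
  refine Ideal.mul_mem_left _ _ ?_
  rw [pow_add, pow_add]
  refine Ideal.mul_mem_mul (Ideal.mul_mem_mul ?_ ?_) hs'
  · simpa using mem_powLattice.1 hv j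
  · simpa using mem_powLattice.1 hw k

end FormalGroupLaw

end PowLattice

/-! ### Multiplication and commutators in a standard group -/

section StandardGroupEstimates

attribute [local instance] localAdicTopology

namespace StandardGroup

variable {R : Type*} [CommRing R] [IsLocalRing R] {d : ℕ}
  {G : Type*} [Group G] [TopologicalSpace G] [IsTopologicalGroup G] (E : StandardGroup R d G)

/-- The coordinates of an element of a standard group, as a vector in `R^d`. -/
def coord (g : G) : Fin d → R := fun i => (E.chart g i : R)

theorem mem_K {n : ℕ} {g : G} : g ∈ E.K n ↔ E.coord g ∈ powLattice R d n :=
  mem_powLattice.symm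

theorem exists_coord_eq {n : ℕ} (hn : 1 ≤ n) {v : Fin d → R} (hv : v ∈ powLattice R d n) :
    ∃ g, E.coord g = v := by
  have hv' : ∀ i, v i ∈ IsLocalRing.maximalIdeal R := fun i => by
    simpa using Ideal.pow_le_pow_right hn (mem_powLattice.1 hv i)
  exact ⟨E.chart.symm fun i => ⟨v i, hv' i⟩, funext fun i => by simp [coord]⟩

theorem K_one : E.K 1 = ⊤ :=
  eq_top_iff.2 fun g _ i => by simp

theorem K_anti {m n : ℕ} (h : m ≤ n) : E.K n ≤ E.K m :=
  fun _ hg i => Ideal.pow_le_pow_right h (hg i)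

theorem coord_mul_congr {n : ℕ} {g g' h h' : G}
    (hg : E.coord g - E.coord g' ∈ powLattice R d n)
    (hh : E.coord h - E.coord h' ∈ powLattice R d n) :
    E.coord (g * h) - E.coord (g' * h') ∈ powLattice R d n :=
  mem_powLattice.2 (E.mul_congr n (mem_powLattice.1 hg) (mem_powLattice.1 hh))

theorem mem_K_iff_sub_one {n : ℕ} {g : G} :
    g ∈ E.K n ↔ E.coord g - E.coord 1 ∈ powLattice R d n := by
  rw [mem_K]
  exact (Submodule.sub_mem_iff_left _ (E.mem_K.1 (E.K n).one_mem)).symm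

theorem inv_mul_mem_K_iff {n : ℕ} {g h : G} :
    g⁻¹ * h ∈ E.K n ↔ E.coord h - E.coord g ∈ powLattice R d n := by
  rw [mem_K_iff_sub_one]
  constructor <;> intro H
  · simpa using E.coord_mul_congr (g := g) (g' := g) (by simp) H
  · simpa using E.coord_mul_congr (g := g⁻¹) (g' := g⁻¹) (by simp) H

/-- Multiplication to second order: the error consists of mixed terms of degree at least three. -/
theorem coord_mul_sub_mem {a b : ℕ} {g h : G} (hg : g ∈ E.K a) (hh : h ∈ E.K b) :
    E.coord (g * h) - (E.coord g + E.coord h + E.law.freeBilin (E.coord g) (E.coord h)) ∈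
      powLattice R d (a + b + min a b) := by
  classical
  rw [mem_K] at hg hh
  refine mem_powLattice.2 fun i => ?_
  have : IsTopologicalRing R :=
    ((IsLocalRing.maximalIdeal R).nonarchimedean).toIsTopologicalRing
  have hc : IsClosed
      ((IsLocalRing.maximalIdeal R ^ (a + b + min a b) : Ideal R) : Set R) :=
    ((IsLocalRing.maximalIdeal R).openAddSubgroup (a + b + min a b)).isClosed
  have key : HasSum (E.law.monomialValue i (E.coord g) (E.coord h)) (E.coord (g * h) i) :=
    E.mul_eq g h i
  set T : Finset (Fin d ⊕ Fin d →₀ ℕ) :=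
    Finset.univ.image (FormalGroupLaw.lowExponent i) with hT
  have hsum : ∑ m ∈ T, E.law.monomialValue i (E.coord g) (E.coord h) m =
      (E.coord g + E.coord h + E.law.freeBilin (E.coord g) (E.coord h)) i := by
    rw [hT, Finset.sum_image fun x _ y _ e => FormalGroupLaw.lowExponent_injective i e,
      E.law.sum_monomialValue_lowExponent]
    rfl
  rw [Pi.sub_apply, ← hsum]
  -- Every partial sum containing the terms of degree at most two satisfies the congruence.
  refine hc.mem_of_tendsto (Filter.Tendsto.sub_const key _)
    ((Filter.eventually_ge_atTop T).mono fun t ht => ?_)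
  change ∑ m ∈ t, _ - ∑ m ∈ T, _ ∈ IsLocalRing.maximalIdeal R ^ (a + b + min a b)
  rw [← Finset.sum_sdiff (show T ⊆ t from ht), add_sub_cancel_right]
  refine Ideal.sum_mem _ fun m hm => E.law.monomialValue_mem hg hh i m ?_
  have := (Finset.mem_sdiff.1 hm).2
  simpa [hT] using this

theorem coord_mul_sub_add_mem {a b : ℕ} {g h : G} (hg : g ∈ E.K a) (hh : h ∈ E.K b) :
    E.coord (g * h) - (E.coord g + E.coord h) ∈ powLattice R d (a + b) := by
  have h1 := powLattice_anti (Nat.le_add_right (a + b) (min a b)) (E.coord_mul_sub_mem hg hh)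
  have h2 := E.law.freeBilin_mem (E.mem_K.1 hg) (E.mem_K.1 hh)
  convert add_mem h1 h2 using 1
  abel

theorem commutatorElement_mem_K {a b : ℕ} {g h : G} (hg : g ∈ E.K a) (hh : h ∈ E.K b) :
    ⁅g, h⁆ ∈ E.K (a + b) := by
  have h1 := E.coord_mul_sub_add_mem hg hh
  have h2 := E.coord_mul_sub_add_mem hh hg
  rw [add_comm b a] at h2
  have h3 : (h * g)⁻¹ * (g * h) ∈ E.K (a + b) := by
    rw [inv_mul_mem_K_iff]
    convert sub_mem h1 h2 using 1
    abel
  have h4 := (E.K_normal (a + b)).conj_mem _ h3 (h * g)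
  convert h4 using 1
  rw [commutatorElement_def]
  group

/-- The group commutator is the Lie bracket to leading order. -/
theorem coord_commutatorElement_sub_mem {a b : ℕ} {g h : G} (hg : g ∈ E.K a) (hh : h ∈ E.K b) :
    E.coord ⁅g, h⁆ - E.law.freeBracket (E.coord g) (E.coord h) ∈
      powLattice R d (a + b + min a b) := by
  have hc := E.commutatorElement_mem_K hg hh
  have hhg : h * g ∈ E.K (min a b) :=
    mul_mem (E.K_anti (min_le_right a b) hh) (E.K_anti (min_le_left a b) hg)
  have h1 := E.coord_mul_sub_add_mem hc hhg
  have e : ⁅g, h⁆ * (h * g) = g * h := by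
    rw [commutatorElement_def]
    group
  rw [e] at h1
  have h2 := E.coord_mul_sub_mem hg hh
  have h3 := E.coord_mul_sub_mem hh hg
  rw [add_comm b a, min_comm b a] at h3
  rw [FormalGroupLaw.freeBracket_apply]
  convert sub_mem (sub_mem h2 h1) h3 using 1
  abel

/-- Perturbed arguments: `⁅s, t⁆` still approximates the bracket of vectors `v`, `w` which are
only approximated by the coordinates of `s`, `t`. -/
theorem coord_commutatorElement_sub_bracket_mem {a b k : ℕ} {s t : G} {v w : Fin d → R}
    (hv : v ∈ powLattice R d a) (hw : w ∈ powLattice R d b)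
    (hs : E.coord s - v ∈ powLattice R d (a + k)) (ht : E.coord t - w ∈ powLattice R d (b + k))
    {e : ℕ} (he : e ≤ a + b + min a b) (hek : e ≤ a + b + k) :
    ⁅s, t⁆ ∈ E.K (a + b) ∧
      E.coord ⁅s, t⁆ - E.law.freeBracket v w ∈ powLattice R d e := by
  have hsa : E.coord s ∈ powLattice R d a := by
    simpa using add_mem (powLattice_anti (Nat.le_add_right a k) hs) hv
  have htb : E.coord t ∈ powLattice R d b := by
    simpa using add_mem (powLattice_anti (Nat.le_add_right b k) ht) hw
  refine ⟨E.commutatorElement_mem_K (E.mem_K.2 hsa) (E.mem_K.2 htb), ?_⟩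
  have h1 := powLattice_anti he
    (E.coord_commutatorElement_sub_mem (E.mem_K.2 hsa) (E.mem_K.2 htb))
  have h2 : E.law.freeBracket (E.coord s - v) (E.coord t) ∈ powLattice R d e :=
    powLattice_anti (by omega) (E.law.freeBracket_mem hs htb)
  have h3 : E.law.freeBracket v (E.coord t - w) ∈ powLattice R d e :=
    powLattice_anti (by omega) (E.law.freeBracket_mem hv ht)
  convert add_mem h1 (add_mem h2 h3) using 1
  simp only [map_sub, LinearMap.sub_apply]
  abel

/-- In a high congruence subgroup, products are sums to leading order. -/
theorem coord_list_prod_sub_sum_mem {e e' : ℕ} (he : e' ≤ e + e) {l : List G}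
    (hl : ∀ x ∈ l, x ∈ E.K e) :
    l.prod ∈ E.K e ∧ E.coord l.prod - (l.map E.coord).sum ∈ powLattice R d e' := by
  induction l with
  | nil =>
    exact ⟨one_mem _, by simpa using E.mem_K.1 (E.K e').one_mem⟩
  | cons x l ih =>
    obtain ⟨h1, h2⟩ := ih fun y hy => hl y (by simp [hy])
    have hx := hl x (by simp)
    rw [List.prod_cons, List.map_cons, List.sum_cons]
    refine ⟨mul_mem hx h1, ?_⟩
    convert add_mem (powLattice_anti he (E.coord_mul_sub_add_mem hx h1)) h2 using 1
    abel

theorem isOpen_K (n : ℕ) : IsOpen (E.K n : Set G) := by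
  have ho : IsOpen ((IsLocalRing.maximalIdeal R ^ n : Ideal R) : Set R) :=
    ((IsLocalRing.maximalIdeal R).openAddSubgroup n).isOpen
  have : (E.K n : Set G) =
      ⋂ i, (fun g => (E.chart g i : R)) ⁻¹' ((IsLocalRing.maximalIdeal R ^ n : Ideal R) : Set R) := by
    ext g
    simp [K]
  rw [this]
  refine isOpen_iInter_of_finite fun i => ho.preimage ?_
  exact continuous_subtype_val.comp ((continuous_apply i).comp E.chart.continuous)

theorem finite_quotient_K [IsNoetherianRing R] [Finite (IsLocalRing.ResidueField R)] (n : ℕ) :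
    Finite (G ⧸ E.K n) := by
  have : Finite (R ⧸ IsLocalRing.maximalIdeal R) :=
    inferInstanceAs (Finite (IsLocalRing.ResidueField R))
  have : Finite (R ⧸ IsLocalRing.maximalIdeal R ^ n) :=
    Ideal.finite_quotient_pow (IsNoetherian.noetherian _) n
  let f : G ⧸ E.K n → (Fin d → R ⧸ IsLocalRing.maximalIdeal R ^ n) :=
    Quotient.lift (fun g i => Ideal.Quotient.mk _ (E.coord g i)) fun g h hgh => funext fun i => by
      rw [Ideal.Quotient.eq, ← neg_mem_iff, neg_sub]
      exact mem_powLattice.1 (E.inv_mul_mem_K_iff.1 (QuotientGroup.leftRel_apply.1 hgh)) i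
  refine Finite.of_injective f fun x y => ?_
  induction x using QuotientGroup.induction_on with | _ g => ?_
  induction y using QuotientGroup.induction_on with | _ h => ?_
  intro hgh
  rw [QuotientGroup.eq, inv_mul_mem_K_iff, mem_powLattice]
  intro i
  exact Ideal.Quotient.eq.1 (congrFun hgh i).symm

end StandardGroup

end StandardGroupEstimates

/-! ### Perfect Lie algebras: vectors as short sums of brackets -/

namespace FormalGroupLaw

variable {R : Type*} [CommRing R] {d : ℕ} (F : FormalGroupLaw R d)

/-- The `R`-span of the brackets in `L(G) = 𝓜^d`. -/
def bracketSpan [IsLocalRing R] : Submodule R (Fin d → IsLocalRing.maximalIdeal R) :=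
  Submodule.span R {z | ∃ x y, F.lieBracket x y = z}

/-- If the Lie algebra over the field of fractions is perfect, the quotient of `L(G)` by the span
of the brackets is torsion, since it vanishes after tensoring with the field of fractions. -/
theorem exists_smul_mem_bracketSpan [IsDomain R] [IsLocalRing R] (h : F.LieAlgPerfect)
    (v : Fin d → IsLocalRing.maximalIdeal R) : ∃ r : R, r ≠ 0 ∧ r • v ∈ F.bracketSpan := by
  let φ := F.bracketSpan.mkQ.baseChange (FractionRing R)
  have hφ : ∀ x y, φ (F.lieAlgBracket x y) = 0 := fun x y => by
    induction x using TensorProduct.induction_on with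
    | zero => simp
    | add x x' hx hx' => rw [map_add, LinearMap.add_apply, map_add, hx, hx', add_zero]
    | tmul a v =>
      induction y using TensorProduct.induction_on with
      | zero => simp
      | add y y' hy hy' => rw [map_add, map_add, hy, hy', add_zero]
      | tmul b w =>
        have h0 : F.bracketSpan.mkQ (F.lieBracket v w) = 0 :=
          (Submodule.Quotient.mk_eq_zero _).2 (Submodule.subset_span ⟨v, w, rfl⟩)
        rw [lieAlgBracket, LinearMap.BilinMap.baseChange_tmul, LinearMap.baseChange_tmul, h0,
          TensorProduct.tmul_zero]
  have hker : F.derivedSubalgebra ≤ LinearMap.ker φ := by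
    refine Submodule.span_le.2 ?_
    rintro _ ⟨x, y, rfl⟩
    exact hφ x y
  rw [show F.derivedSubalgebra = ⊤ from h] at hker
  have h0 : TensorProduct.mk R (FractionRing R) _ 1 (F.bracketSpan.mkQ v) = 0 := by
    have : φ (1 ⊗ₜ v) = 0 := hker Submodule.mem_top
    simpa [φ] using this
  obtain ⟨s, hs⟩ := (IsLocalizedModule.eq_zero_iff (nonZeroDivisors R)
    (TensorProduct.mk R (FractionRing R) _ 1)).1 h0
  refine ⟨s, nonZeroDivisors.coe_ne_zero s, ?_⟩
  rw [← Submodule.Quotient.mk_eq_zero]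
  exact hs

theorem exists_eq_sum_freeBracket [IsLocalRing R] {z : Fin d → IsLocalRing.maximalIdeal R}
    (hz : z ∈ F.bracketSpan) :
    ∃ w : Fin d → Fin d → R,
      (fun i => (z i : R)) = ∑ k, F.freeBracket (w k) (Pi.single k 1) := by
  classical
  induction hz using Submodule.span_induction with
  | mem z hz =>
    obtain ⟨x, y, rfl⟩ := hz
    refine ⟨fun k => (y k : R) • fun j => (x j : R), ?_⟩
    have hy : (fun j => (y j : R)) = ∑ k, (y k : R) • (Pi.single k 1 : Fin d → R) := by
      funext j
      simp [Finset.sum_apply, Pi.single_apply]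
    rw [funext (F.coe_lieBracket x y)]
    change F.freeBracket _ (fun j => (y j : R)) = _
    rw [hy, map_sum]
    simp only [map_smul, LinearMap.smul_apply]
  | zero => exact ⟨0, by funext i; simp⟩
  | add x y _ _ hx hy =>
    obtain ⟨w, hw⟩ := hx
    obtain ⟨w', hw'⟩ := hy
    refine ⟨w + w', ?_⟩
    simp only [Pi.add_apply, map_add, LinearMap.add_apply, Finset.sum_add_distrib, ← hw, ← hw']
    rfl
  | smul r x _ hx =>
    obtain ⟨w, hw⟩ := hx
    refine ⟨r • w, ?_⟩
    simp only [Pi.smul_apply, map_smul, LinearMap.smul_apply, ← Finset.smul_sum, ← hw]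
    rfl

/-- Over a discrete valuation ring, perfectness of the Lie algebra makes every vector of `R^d` of
depth `a + b + c` a sum of `d` brackets of vectors of depths `a` and `b`; the loss `c` depends only
on the formal group law. -/
theorem exists_bracket_decomposition [IsDomain R] [IsDiscreteValuationRing R] (h : F.LieAlgPerfect) :
    ∃ c, 1 ≤ c ∧ ∀ a b, ∀ v ∈ powLattice R d (a + b + c), ∃ w u : Fin d → Fin d → R,
      (∀ k, w k ∈ powLattice R d a) ∧ (∀ k, u k ∈ powLattice R d b) ∧
        v = ∑ k, F.freeBracket (w k) (u k) := by
  classical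
  obtain ⟨ϖ, hϖ⟩ := IsDiscreteValuationRing.exists_irreducible R
  have hmax := hϖ.maximalIdeal_eq
  have hϖm : ϖ ∈ IsLocalRing.maximalIdeal R := hmax ▸ Ideal.mem_span_singleton_self ϖ
  have key : ∀ i : Fin d, ∃ n : ℕ, ∃ w : Fin d → Fin d → R,
      ϖ ^ n • (Pi.single i 1 : Fin d → R) = ∑ k, F.freeBracket (w k) (Pi.single k 1) := fun i => by
    obtain ⟨r, hr, hrm⟩ := F.exists_smul_mem_bracketSpan h (Pi.single i ⟨ϖ, hϖm⟩)
    obtain ⟨n, u, hu⟩ := IsDiscreteValuationRing.associated_pow_irreducible hr hϖ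
    obtain ⟨w, hw⟩ := F.exists_eq_sum_freeBracket (Submodule.smul_mem _ (u : R) hrm)
    refine ⟨n + 1, w, ?_⟩
    rw [← hw, pow_succ, ← hu]
    funext j
    by_cases hj : j = i
    · subst hj
      simp
      ring
    · simp [hj]
  choose n w hw using key
  have hle : ∀ i, n i ≤ ∑ j, n j := fun i =>
    Finset.single_le_sum (f := n) (fun _ _ => Nat.zero_le _) (Finset.mem_univ i)
  refine ⟨∑ j, n j + 1, Nat.le_add_left 1 _, fun a b v hv => ?_⟩
  have hdvd : ∀ i, ∃ t, v i = ϖ ^ (a + b + (∑ j, n j + 1)) * t := fun i => by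
    have := mem_powLattice.1 hv i
    rw [hmax, Ideal.span_singleton_pow, Ideal.mem_span_singleton] at this
    exact this
  choose t ht using hdvd
  refine ⟨fun k => ϖ ^ a • ∑ i, (t i * ϖ ^ (∑ j, n j + 1 - n i)) • w i k,
    fun k => ϖ ^ b • Pi.single k 1,
    fun k => smul_mem_powLattice (Ideal.pow_mem_pow hϖm a) _,
    fun k => smul_mem_powLattice (Ideal.pow_mem_pow hϖm b) _, ?_⟩
  have hv' : v = ∑ i, (ϖ ^ a * ϖ ^ b * (t i * ϖ ^ (∑ j, n j + 1 - n i))) •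
      (ϖ ^ n i • (Pi.single i 1 : Fin d → R)) := by
    funext l
    simp only [Finset.sum_apply, Pi.smul_apply, Pi.single_apply, smul_eq_mul, mul_ite, mul_one,
      mul_zero, Finset.sum_ite_eq, Finset.mem_univ, if_true]
    rw [ht l, pow_add, pow_add,
      ← Nat.sub_add_cancel (show n l ≤ ∑ j, n j + 1 from (hle l).trans (Nat.le_succ _)), pow_add,
      Nat.sub_add_cancel (show n l ≤ ∑ j, n j + 1 from (hle l).trans (Nat.le_succ _))]
    ring
  rw [hv']
  simp only [hw, Finset.smul_sum, map_smul, LinearMap.smul_apply, map_sum, LinearMap.sum_apply]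
  rw [Finset.sum_comm]
  refine Finset.sum_congr rfl fun k _ => Finset.sum_congr rfl fun i _ => ?_
  simp only [smul_smul]
  congr 1
  ring

end FormalGroupLaw

/-! ### The Solovay-Kitaev iteration -/

namespace StandardGroup

attribute [local instance] localAdicTopology

section Covers

variable {R : Type*} [CommRing R] [IsLocalRing R] {d : ℕ}
  {G : Type*} [Group G] [TopologicalSpace G] [IsTopologicalGroup G] (E : StandardGroup R d G)

/-- Words of length `ℓ` in `S` approximate every element of `K_a` up to an error in `K_b`. -/
def Covers (S : Set G) (ℓ a b : ℕ) : Prop :=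
  ∀ g ∈ E.K a, ∃ s ∈ wordBall S ℓ, s⁻¹ * g ∈ E.K b

variable {E} {S : Set G}

theorem Covers.mono {ℓ ℓ' a b : ℕ} (h : E.Covers S ℓ a b) (hℓ : ℓ ≤ ℓ') : E.Covers S ℓ' a b :=
  fun g hg => let ⟨s, hs, hsg⟩ := h g hg
    ⟨s, wordBall_mono S hℓ hs, hsg⟩

theorem Covers.trans {ℓ ℓ' a b c : ℕ} (h : E.Covers S ℓ a b) (h' : E.Covers S ℓ' b c) :
    E.Covers S (ℓ + ℓ') a c := fun g hg => by
  obtain ⟨s, hs, hsg⟩ := h g hg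
  obtain ⟨t, ht, htg⟩ := h' _ hsg
  exact ⟨s * t, mul_mem_wordBall hs ht, by rwa [mul_inv_rev, mul_assoc]⟩

/-- `c` is the loss of depth in writing vectors as sums of `d` brackets. -/
theorem Covers.commutator {c : ℕ}
    (hdec : ∀ a b, ∀ v ∈ powLattice R d (a + b + c), ∃ w u : Fin d → Fin d → R,
      (∀ k, w k ∈ powLattice R d a) ∧ (∀ k, u k ∈ powLattice R d b) ∧
        v = ∑ k, E.law.freeBracket (w k) (u k))
    {ℓ a b k : ℕ} (ha : Covers E S ℓ a (a + k)) (hb : Covers E S ℓ b (b + k))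
    (ha1 : 1 ≤ a) (hb1 : 1 ≤ b) (hka : k ≤ a) (hkb : k ≤ b) :
    Covers E S (d * (4 * ℓ)) (a + b + c) (a + b + k) := fun g hg => by
  obtain ⟨w, u, hw, hu, e⟩ := hdec a b _ (E.mem_K.1 hg)
  have approx : ∀ {a : ℕ} {v : Fin d → R}, 1 ≤ a → E.Covers S ℓ a (a + k) →
      v ∈ powLattice R d a → ∃ s ∈ wordBall S ℓ, E.coord s - v ∈ powLattice R d (a + k) := by
    intro a v ha1 ha hv
    obtain ⟨x, rfl⟩ := E.exists_coord_eq ha1 hv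
    obtain ⟨s, hs, hsx⟩ := ha x (E.mem_K.2 hv)
    refine ⟨s, hs, ?_⟩
    rw [← neg_mem_iff, neg_sub]
    exact E.inv_mul_mem_K_iff.1 hsx
  choose s hs hsw using fun i => approx ha1 ha (hw i)
  choose t ht htu using fun i => approx hb1 hb (hu i)
  have hc := fun i => E.coord_commutatorElement_sub_bracket_mem (hw i) (hu i) (hsw i) (htu i)
    (e := a + b + k) (by omega) le_rfl
  set l : List G := List.ofFn fun i => ⁅s i, t i⁆ with hl
  refine ⟨l.prod, ?_, ?_⟩
  · have := list_prod_mem_wordBall (S := S) (n := 4 * ℓ) (l := l) fun x hx => by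
      obtain ⟨i, rfl⟩ := List.mem_ofFn.1 hx
      exact commutatorElement_mem_wordBall (hs i) (ht i)
    simpa [hl] using this
  · have hprod := (E.coord_list_prod_sub_sum_mem (e := a + b) (e' := a + b + k) (by omega) (l := l)
      fun x hx => by
        obtain ⟨i, rfl⟩ := List.mem_ofFn.1 hx
        exact (hc i).1).2
    have hsum : (l.map E.coord).sum - E.coord g ∈ powLattice R d (a + b + k) := by
      rw [hl, List.map_ofFn, List.sum_ofFn, e, ← Finset.sum_sub_distrib]
      exact Submodule.sum_mem _ fun i _ => (hc i).2
    rw [inv_mul_mem_K_iff, ← neg_mem_iff, neg_sub]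
    convert add_mem hprod hsum using 1
    abel

/-- Two overlapping applications of the commutator step at depths of about `m / 2` cover a window
of width `2 * c` at depth `m`, so doubling the depth multiplies the word length by a constant. -/
theorem covers_of_base {c ℓ D : ℕ} (hD : 8 * d ≤ D) (hD1 : 1 ≤ D) (hc : 1 ≤ c)
    (hdec : ∀ a b, ∀ v ∈ powLattice R d (a + b + c), ∃ w u : Fin d → Fin d → R,
      (∀ k, w k ∈ powLattice R d a) ∧ (∀ k, u k ∈ powLattice R d b) ∧
        v = ∑ k, E.law.freeBracket (w k) (u k))
    (hbase : ∀ m ≤ 6 * c, Covers E S ℓ m (m + 2 * c)) (j : ℕ) :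
    ∀ m ≤ 2 ^ j * (6 * c), Covers E S (ℓ * D ^ j) m (m + 2 * c) := by
  induction j with
  | zero => simpa using hbase
  | succ j ih =>
    intro m hm
    have hle : ℓ * D ^ j ≤ ℓ * D ^ (j + 1) :=
      Nat.mul_le_mul_left _ (Nat.pow_le_pow_right hD1 (Nat.le_succ j))
    by_cases hm0 : m ≤ 6 * c
    · exact (ih m (hm0.trans (Nat.le_mul_of_pos_left _ (by positivity)))).mono hle
    -- As `m > 6 * c`, both halves of `m - c` are at least the window width `2 * c`.
    have hhalf : ∀ a, 2 * a ≤ m + 1 → a ≤ 2 ^ j * (6 * c) := fun a ha => by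
      have : 2 ^ (j + 1) * (6 * c) = 2 * (2 ^ j * (6 * c)) := by ring
      omega
    have step : ∀ n, m ≤ n → n ≤ m + c →
        Covers E S (d * (4 * (ℓ * D ^ j))) n (n + c) := fun n hmn hnm => by
      have h := Covers.commutator hdec (ih ((n - c) / 2) (hhalf _ (by omega)))
        (ih (n - c - (n - c) / 2) (hhalf _ (by omega)))
        (by omega) (by omega) (by omega) (by omega)
      rwa [show (n - c) / 2 + (n - c - (n - c) / 2) + c = n by omega,
        show (n - c) / 2 + (n - c - (n - c) / 2) + 2 * c = n + c by omega] at h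
    have h := (step m le_rfl (Nat.le_add_right m c)).trans (step (m + c) (by omega) le_rfl)
    rw [show m + c + c = m + 2 * c by ring] at h
    refine h.mono ?_
    calc d * (4 * (ℓ * D ^ j)) + d * (4 * (ℓ * D ^ j)) = (8 * d) * (ℓ * D ^ j) := by ring
      _ ≤ D * (ℓ * D ^ j) := Nat.mul_le_mul_right _ hD
      _ = ℓ * D ^ (j + 1) := by ring

theorem covers_iterate {ℓ k N : ℕ} (h : ∀ m ≤ N, Covers E S ℓ m (m + k)) (i : ℕ)
    (hi : 1 + i * k ≤ N) : Covers E S (i * ℓ) 1 (1 + i * k) := by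
  induction i with
  | zero => exact fun g hg => ⟨1, one_mem_wordBall S _, by simpa using hg⟩
  | succ i ih =>
    rw [add_mul, add_mul, one_mul, one_mul] at *
    exact add_assoc 1 (i * k) k ▸ (ih (by omega)).trans (h _ (by omega))

variable (E) in
theorem worstDiam_quotient_K_le {r n : ℕ}
    (h : ∀ S : Set G, Subgroup.closure S = ⊤ → E.Covers S r 1 n) :
    worstDiam (G ⧸ E.K n) ≤ r := by
  refine worstDiam_le fun S hS => Set.eq_univ_of_forall fun q => ?_
  have hsurj := QuotientGroup.mk'_surjective (E.K n)
  obtain ⟨g, rfl⟩ := hsurj q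
  obtain ⟨s, hs, hsg⟩ := h _ (closure_preimage_insert_one hsurj hS) g (by simp [E.K_one])
  rw [← wordBall_insert_one, ← Set.image_preimage_eq (insert 1 S) hsurj, ← image_wordBall]
  exact ⟨s, hs, QuotientGroup.eq.2 hsg⟩

end Covers

variable {R : Type*} [CommRing R] [IsDomain R] [IsDiscreteValuationRing R]
  [Finite (IsLocalRing.ResidueField R)] {d : ℕ}
  {G : Type*} [Group G] [TopologicalSpace G] [IsTopologicalGroup G] (E : StandardGroup R d G)

/-- For bounded depth, words of bounded length suffice, uniformly in the generating set. -/
theorem exists_covers_base (M : ℕ) :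
    ∃ ℓ, ∀ S : Set G, Subgroup.closure S = ⊤ → ∀ a b, b ≤ M → E.Covers S ℓ a b := by
  have := E.finite_quotient_K M
  obtain ⟨ℓ, hℓ⟩ := exists_forall_wordBall_eq_univ (G ⧸ E.K M)
  refine ⟨ℓ, fun S hS a b hb g _ => ?_⟩
  have himg : Subgroup.closure (QuotientGroup.mk' (E.K M) '' S) = ⊤ := by
    rw [← MonoidHom.map_closure, hS, ← MonoidHom.range_eq_map]
    exact MonoidHom.range_eq_top.2 (QuotientGroup.mk'_surjective _)
  have hmem : QuotientGroup.mk' (E.K M) g ∈ QuotientGroup.mk' (E.K M) '' wordBall S ℓ := by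
    rw [image_wordBall, hℓ _ himg]
    trivial
  obtain ⟨s, hs, e⟩ := hmem
  exact ⟨s, hs, E.K_anti hb (QuotientGroup.eq.1 e)⟩

theorem exists_covers_polynomial (h : E.law.LieAlgPerfect) :
    ∃ A : ℕ, ∀ S : Set G, Subgroup.closure S = ⊤ →
      ∀ n, 1 ≤ n → E.Covers S (A * n ^ (d + 4)) 1 n := by
  obtain ⟨c, hc, hdec⟩ := E.law.exists_bracket_decomposition h
  obtain ⟨ℓ, hℓ⟩ := E.exists_covers_base (6 * c + 2 * c)
  refine ⟨ℓ * 2 ^ (d + 3), fun S hS n hn => ?_⟩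
  have hD : 8 * d ≤ 2 ^ (d + 3) := by
    have := (Nat.lt_two_pow_self (n := d)).le
    rw [pow_add]
    omega
  set j := Nat.clog 2 n with hj
  have hwin := covers_of_base (E := E) (S := S) hD Nat.one_le_two_pow hc hdec
    (fun m hm => hℓ S hS m _ (by omega)) j
  have hnj : n ≤ 2 ^ j := Nat.le_pow_clog (by norm_num) n
  have hjn : 2 ^ j ≤ 2 * n := by
    rcases hn.eq_or_lt with rfl | hn'
    · simp [hj]
    · have h1 : 2 ^ j.pred < n := Nat.pow_pred_clog_lt_self (by norm_num) hn'
      have h2 : 0 < j := Nat.clog_pos (by norm_num) hn'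
      have h3 : 2 ^ j = 2 * 2 ^ j.pred := by
        rw [← pow_succ', ← Nat.succ_eq_add_one, Nat.succ_pred h2.ne']
      omega
  have hiter := covers_iterate hwin n (by nlinarith)
  have hlen : n * (ℓ * (2 ^ (d + 3)) ^ j) ≤ ℓ * 2 ^ (d + 3) * n ^ (d + 4) := by
    calc n * (ℓ * (2 ^ (d + 3)) ^ j) = n * (ℓ * (2 ^ j) ^ (d + 3)) := by
          rw [← pow_mul, ← pow_mul, mul_comm (d + 3) j]
      _ ≤ n * (ℓ * (2 * n) ^ (d + 3)) := by gcongr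
      _ = ℓ * 2 ^ (d + 3) * n ^ (d + 4) := by ring
  intro g hg
  obtain ⟨s, hs, hsg⟩ := hiter.mono hlen g hg
  exact ⟨s, hs, E.K_anti (by nlinarith) hsg⟩

/-- Each layer `K_n / K_{n+1}` is nontrivial in positive dimension. -/
theorem two_pow_le_card_quotient_K (hd : 0 < d) (n : ℕ) :
    2 ^ n ≤ Nat.card (G ⧸ E.K (n + 1)) := by
  induction n with
  | zero =>
    have := E.finite_quotient_K 1
    exact Nat.card_pos
  | succ n ih =>
    have := E.finite_quotient_K (n + 1 + 1)
    have hindex := Subgroup.relIndex_mul_index (E.K_anti (Nat.le_add_right (n + 1) 1))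
    have hpos : (E.K (n + 1 + 1)).index ≠ 0 := Subgroup.index_ne_zero_of_finite
    have hne : (E.K (n + 1 + 1)).relIndex (E.K (n + 1)) ≠ 1 := fun h1 => by
      obtain ⟨ϖ, hϖ⟩ := IsDiscreteValuationRing.exists_irreducible R
      have hmax := hϖ.maximalIdeal_eq
      have hϖm : ϖ ∈ IsLocalRing.maximalIdeal R := hmax ▸ Ideal.mem_span_singleton_self ϖ
      have hv : (fun _ => ϖ ^ (n + 1) : Fin d → R) ∈ powLattice R d (n + 1) :=
        mem_powLattice.2 fun _ => Ideal.pow_mem_pow hϖm _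
      obtain ⟨g, hg⟩ := E.exists_coord_eq (Nat.le_add_left 1 n) hv
      have := E.mem_K.1 (Subgroup.relIndex_eq_one.1 h1 (E.mem_K.2 (hg ▸ hv)))
      have := mem_powLattice.1 (hg ▸ this) ⟨0, hd⟩
      rw [hmax, Ideal.span_singleton_pow, Ideal.mem_span_singleton,
        pow_dvd_pow_iff hϖ.ne_zero hϖ.not_isUnit] at this
      omega
    have h0 : (E.K (n + 1 + 1)).relIndex (E.K (n + 1)) ≠ 0 := fun h0 => by
      rw [h0, zero_mul] at hindex
      exact hpos hindex.symm
    rw [← Subgroup.index_eq_card] at ih ⊢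
    rw [← hindex, pow_succ']
    exact Nat.mul_le_mul (by omega) ih

end StandardGroup

theorem theorem1p2 (d : ℕ) :
    ∃ C₂ : ℝ, 0 < C₂ ∧
      ∀ (p : ℕ) [Fact p.Prime] (R : Type*) [CommRing R] [IsDomain R] [IsDiscreteValuationRing R]
        [IsAdicComplete (IsLocalRing.maximalIdeal R) R]
        [Finite (IsLocalRing.ResidueField R)] [CharP (IsLocalRing.ResidueField R) p]
        (G : Type*) [Group G] [TopologicalSpace G] [IsTopologicalGroup G]
        (E : StandardGroup R d G), E.law.LieAlgPerfect →
        ∃ C₁ : ℝ, 0 < C₁ ∧ ∀ n : ℕ, 1 ≤ n →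
          IsOpen (E.K n : Set G) ∧ Finite (G ⧸ E.K n) ∧
            (worstDiam (G ⧸ E.K n) : ℝ) ≤ C₁ * Real.log (Nat.card (G ⧸ E.K n)) ^ C₂ := by
  refine ⟨(d + 4 : ℕ), by positivity, ?_⟩
  intro p _ R _ _ _ _ _ _ G _ _ _ E hperf
  obtain ⟨A, hA⟩ := E.exists_covers_polynomial hperf
  refine ⟨(A + 1) * 4 ^ (d + 4), by positivity, fun n hn =>
    ⟨E.isOpen_K n, E.finite_quotient_K n, ?_⟩⟩
  rw [Real.rpow_natCast]
  -- For trivial quotients the logarithm vanishes, and so does the diameter.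
  by_cases htriv : ∀ S : Set G, E.Covers S 0 1 n
  · have h0 : worstDiam (G ⧸ E.K n) = 0 :=
      Nat.le_zero.1 (E.worstDiam_quotient_K_le fun S _ => htriv S)
    rw [h0, Nat.cast_zero]
    exact mul_nonneg (by positivity) (pow_nonneg (Real.log_natCast_nonneg _) _)
  have htriv' : ¬ E.K 1 ≤ E.K n := fun hle => htriv fun S g hg =>
    ⟨1, one_mem_wordBall S 0, by simpa using hle hg⟩
  have hd : 0 < d := by
    rcases Nat.eq_zero_or_pos d with rfl | hd
    · exact absurd (fun g _ i => i.elim0) htriv'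
    · exact hd
  obtain ⟨m, rfl⟩ : ∃ m, n = m + 2 := by
    refine ⟨n - 2, ?_⟩
    have : n ≠ 1 := fun h => htriv' (by rw [h])
    omega
  have hlog : ((m + 2 : ℕ) : ℝ) ≤ 4 * Real.log (Nat.card (G ⧸ E.K (m + 2))) := by
    have h1 : ((2 ^ (m + 1) : ℕ) : ℝ) ≤ Nat.card (G ⧸ E.K (m + 2)) :=
      Nat.cast_le.2 (E.two_pow_le_card_quotient_K hd (m + 1))
    have h2 := Real.log_le_log (by positivity) h1
    rw [Nat.cast_pow, Real.log_pow, Nat.cast_ofNat] at h2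
    have h3 : (m + 1 : ℕ) * (1 / 2 : ℝ) ≤ (m + 1 : ℕ) * Real.log 2 := by
      gcongr
      linarith [Real.log_two_gt_d9]
    push_cast at h2 h3 ⊢
    linarith [(Nat.cast_nonneg m : (0 : ℝ) ≤ m)]
  have hdiam := E.worstDiam_quotient_K_le fun S hS => hA S hS (m + 2) hn
  calc (worstDiam (G ⧸ E.K (m + 2)) : ℝ) ≤ ((A * (m + 2) ^ (d + 4) : ℕ) : ℝ) :=
        Nat.cast_le.2 hdiam
    _ = A * ((m + 2 : ℕ) : ℝ) ^ (d + 4) := by push_cast; ring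
    _ ≤ (A + 1) * (4 * Real.log (Nat.card (G ⧸ E.K (m + 2)))) ^ (d + 4) := by
        gcongr
        linarith
    _ = _ := by ring
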